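/- Let $H$ be a complex Hilbert space and let $A,B,X\in B(H)$ with $A,B$ positive and invertible. Let $|||\cdot|||$ be a unitarily invariant norm: a norm on a linear subspace $\mathcal J\subseteq B(H)$ in which $\mathcal J$ is complete, such that $UTV\in\mathcal J$ and $|||UTV|||=|||T|||$ for all $T\in\mathcal J$ and all unitary $U,V\in B(H)$ (so $\mathcal J$ is a two-sided ideal), with the convention $|||T|||=\infty$ for $T\in B(H)\setminus\mathcal J$. For real $\nu$ put $h(\nu)=A^{\nu}XB^{1-\nu}+A^{1-\nu}XB^{\nu}$. Let $\alpha,\beta$ be real numbers, $\gamma(t)=(1-t)\alpha+t\beta$, and for integers $n,m\ge 1$ $$E_n=\frac1{2^{n-1}}\sum_{i=1}^{2^{n-1}}h\!\left(\gamma\!\left(\tfrac{2i-1}{2^n}\right)\right),\qquad F_m=\frac1{2^m}\sum_{i=1}^{2^{m-1}}\left[h\!\left(\gamma\!\left(\tfrac{i-1}{2^{m-1}}\right)\right)+h\!\left(\gamma\!\left(\tfrac{i}{2^{m-1}}\right)\right)\right].$$ Then $\nu\mapsto h(\nu)$ is integrable (in the operator norm) between $\alpha$ and $\beta$, and for all $n,m\ge1$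 $$\left|\left|\left|h\!\left(\tfrac{\alpha+\beta}2\right)\right|\right|\right|=|||E_1|||\le\dots\le|||E_n|||\le\frac1{|\beta-\alpha|}\left|\left|\left|\int_\alpha^\beta h(\nu)\,d\nu\right|\right|\right|\le|||F_m|||\le\dots\le|||F_1|||=\frac12\,|||h(\alpha)+h(\beta)|||,$$ where the two inequalities involving the integral are asserted for $\alpha\ne\beta$. -/

import Mathlib

open scoped ENNReal Topology

/-- A unitarily invariant norm on (an ideal of) the bounded operators of a complex Hilbert space,
in the usual convention that the norm is `∞` for the operators outside its ideal.
The operators of finite norm form a linear subspace `J` that is stable under multiplication by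
unitaries on both sides; as every bounded operator is a linear combination of unitaries, `J` is a
two-sided ideal. As always for norm ideals of operators, `J` is complete in its norm. -/
structure UnitarilyInvariantNorm (H : Type*) [NormedAddCommGroup H] [InnerProductSpace ℂ H]
    [CompleteSpace H] where
  /-- the value of the norm, `∞` outside the ideal -/
  toFun : (H →L[ℂ] H) → ℝ≥0∞
  eq_zero_iff : ∀ T : H →L[ℂ] H, toFun T = 0 ↔ T = 0
  smul : ∀ (c : ℂ) (T : H →L[ℂ] H), toFun (c • T) = ENNReal.ofReal ‖c‖ * toFun T
  add_le : ∀ S T : H →L[ℂ] H, toFun (S + T) ≤ toFun S + toFun T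
  unitary_mul_mul : ∀ U ∈ unitary (H →L[ℂ] H), ∀ V ∈ unitary (H →L[ℂ] H), ∀ T : H →L[ℂ] H,
    toFun (U * T * V) = toFun T
  complete : ∀ u : ℕ → (H →L[ℂ] H), (∀ n, toFun (u n) < ∞) →
    (∀ ε : ℝ≥0∞, 0 < ε → ∃ n₀ : ℕ, ∀ k ≥ n₀, ∀ l ≥ n₀, toFun (u k - u l) < ε) →
    ∃ T : H →L[ℂ] H, toFun T < ∞ ∧
      Filter.Tendsto (fun n => toFun (u n - T)) Filter.atTop (𝓝 0)

instance UnitarilyInvariantNorm.instCoeFun (H : Type*) [NormedAddCommGroup H]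
    [InnerProductSpace ℂ H] [CompleteSpace H] :
    CoeFun (UnitarilyInvariantNorm H) (fun _ => (H →L[ℂ] H) → ℝ≥0∞) :=
  ⟨UnitarilyInvariantNorm.toFun⟩

noncomputable section

/-- The Heinz term `A ^ ν X B ^ (1 - ν) + A ^ (1 - ν) X B ^ ν`; the real powers are those of the
continuous functional calculus. -/
def heinzTerm {H : Type*} [NormedAddCommGroup H] [InnerProductSpace ℂ H] [CompleteSpace H]
    (A B X : H →L[ℂ] H) (ν : ℝ) : H →L[ℂ] H :=
  A ^ ν * X * B ^ (1 - ν) + A ^ (1 - ν) * X * B ^ ν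

/-- The segment `γ(t) = (1 - t) α + t β`. -/
def segmentPath (α β t : ℝ) : ℝ := (1 - t) * α + t * β

/-- The dyadic midpoint sum `E_n`, for `n ≥ 1`. -/
def midpointSum {H : Type*} [NormedAddCommGroup H] [InnerProductSpace ℂ H] [CompleteSpace H]
    (A B X : H →L[ℂ] H) (α β : ℝ) (n : ℕ) : H →L[ℂ] H :=
  (1 / (2 : ℝ) ^ (n - 1)) • ∑ i ∈ Finset.Icc (1 : ℕ) (2 ^ (n - 1)),
    heinzTerm A B X (segmentPath α β ((2 * (i : ℝ) - 1) / 2 ^ n))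

/-- The dyadic trapezoid sum `F_m`, for `m ≥ 1`. -/
def trapezoidSum {H : Type*} [NormedAddCommGroup H] [InnerProductSpace ℂ H] [CompleteSpace H]
    (A B X : H →L[ℂ] H) (α β : ℝ) (m : ℕ) : H →L[ℂ] H :=
  (1 / (2 : ℝ) ^ m) • ∑ i ∈ Finset.Icc (1 : ℕ) (2 ^ (m - 1)),
    (heinzTerm A B X (segmentPath α β (((i : ℝ) - 1) / 2 ^ (m - 1)))
      + heinzTerm A B X (segmentPath α β ((i : ℝ) / 2 ^ (m - 1))))

end

/-!
Write `a = log A`, `b = log B`, and let `D T = a T - T b` be the corresponding derivation. The Heinz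
term is a hyperbolic cosine, `h (1 / 2 + s) = 2 cosh (s D) (A ^ (1 / 2) X B ^ (1 / 2))`
(`heinzTerm_eq_coshConj`), so the addition theorem for `cosh` relates the sums to one another: with
`s = (β - α) / 2 ^ n`,

* `E_n = cosh (s D) E_{n-1}` (`midpointSum_succ`) and `F_n = cosh (s D) E_n`
  (`trapezoidSum_eq_coshConj`),
* `F_{n+1} = (F_n + E_n) / 2` (`trapezoidSum_succ`).

The discrete inequalities therefore all follow from `N T ≤ N (cosh (s D) T)`
(`UnitarilyInvariantNorm.le_coshConj`). Its source is a fact about Banach algebras: if `exp (i t d)`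
is a contraction for all real `t`, then `cosh d` has a contractive inverse
(`hasContractiveInverse_cosh`). Indeed `1 - w` has a contractive inverse when `w` generates
a group of contractions, by the Laplace transform; `cosh d` is the limit of the polynomials
`((1 + d / n) ^ n + (1 - d / n) ^ n) / 2`, whose roots are imaginary, so that they are products of
such factors. The fact is applied to the algebra of bounded operators on the ideal of finite norm,
which is a Banach space under `N`; unitary invariance makes `exp (i t D)` isometric. It is also
applied to the operator norm, so that `cosh (s D)` is injective on all bounded operators and no
finiteness has to be assumed.

In the operator norm, `E_n` tends to the mean value of `h` (`tendsto_midpointSum`). The norm `N` need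
not be semicontinuous for the operator norm, so the inequalities with the integral come from
convergence in the ideal: the factors `cosh (s D)` are within a constant times `|s|` of the identity
there and the `s` are summable. This gives `N (∫ h) / |β - α| ≤ N F_m`
(`UnitarilyInvariantNorm.le_of_tendsto_coshConj`). For `N E_n ≤ N (∫ h) / |β - α|` the inverse factors
are applied to the integral, and the result converges to `E_n` in both norms
(`UnitarilyInvariantNorm.le_of_coshConj_tendsto`).
-/

/-! ### Hyperbolic cosines in Banach algebras -/

/-- The element `x` is invertible and its inverse has norm at most one. -/
def HasContractiveInverse {R : Type*} [NormedRing R] (x : R) : Prop :=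
  ∃ v : R, x * v = 1 ∧ v * x = 1 ∧ ‖v‖ ≤ 1

namespace HasContractiveInverse

variable {R : Type*} [NormedRing R]

theorem mul {x y : R} (hx : HasContractiveInverse x) (hy : HasContractiveInverse y) :
    HasContractiveInverse (x * y) := by
  obtain ⟨v, hv, hv', hvn⟩ := hx
  obtain ⟨w, hw, hw', hwn⟩ := hy
  refine ⟨w * v, ?_, ?_, ?_⟩
  · rw [mul_assoc, ← mul_assoc y, hw, one_mul, hv]
  · rw [mul_assoc, ← mul_assoc v, hv', one_mul, hw']
  · exact (norm_mul_le _ _).trans (mul_le_one₀ hwn (norm_nonneg _) hvn)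

/-- Having a contractive inverse is a closed condition: the inverses of a convergent sequence
form a Cauchy sequence, because `v - w = v * (y - x) * w` for inverses `v` of `x` and `w` of `y`. -/
theorem of_tendsto [CompleteSpace R] {c : ℕ → R} {x : R}
    (hc : ∀ᶠ n in Filter.atTop, HasContractiveInverse (c n))
    (hx : Filter.Tendsto c Filter.atTop (𝓝 x)) : HasContractiveInverse x := by
  obtain ⟨n₀, hn₀⟩ := Filter.eventually_atTop.1 hc
  replace hc : ∀ n, HasContractiveInverse (c (n + n₀)) := fun n => hn₀ _ (by omega)
  replace hx : Filter.Tendsto (fun n => c (n + n₀)) Filter.atTop (𝓝 x) :=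
    (Filter.tendsto_add_atTop_iff_nat n₀).2 hx
  choose v hv hv' hvn using hc
  have hd : ∀ k l, dist (v k) (v l) ≤ dist (c (k + n₀)) (c (l + n₀)) := by
    intro k l
    have : v k - v l = v k * (c (l + n₀) - c (k + n₀)) * v l := by
      rw [mul_sub, sub_mul, mul_assoc, hv, hv', mul_one, one_mul]
    rw [dist_eq_norm, dist_comm, dist_eq_norm, this]
    calc ‖v k * (c (l + n₀) - c (k + n₀)) * v l‖
        ≤ ‖v k‖ * ‖c (l + n₀) - c (k + n₀)‖ * ‖v l‖ := norm_mul₃_le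
      _ ≤ 1 * ‖c (l + n₀) - c (k + n₀)‖ * 1 := by
          gcongr
          · exact hvn k
          · exact hvn l
      _ = _ := by ring
  have hcau : CauchySeq v := by
    rw [Metric.cauchySeq_iff]
    intro ε hε
    obtain ⟨m, hm⟩ := Metric.cauchySeq_iff.1 hx.cauchySeq ε hε
    exact ⟨m, fun k hk l hl => (hd k l).trans_lt (hm k hk l hl)⟩
  obtain ⟨w, hw⟩ := cauchySeq_tendsto_of_complete hcau
  refine ⟨w, ?_, ?_, ?_⟩
  · refine tendsto_nhds_unique (hx.mul hw) ?_
    simp [hv]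
  · refine tendsto_nhds_unique (hw.mul hx) ?_
    simp [hv']
  · exact le_of_tendsto hw.norm (Filter.Eventually.of_forall hvn)

end HasContractiveInverse

section BanachAlgebra

variable {R : Type*} [NormedRing R] [NormedAlgebra ℂ R] [CompleteSpace R]

open NormedSpace Filter MeasureTheory in
/-- If `w` generates a group of contractions, the inverse of `1 - w` is the Laplace transform
`∫ s in (0, ∞), e⁻ˢ exp (s w)`, hence a contraction. -/
theorem hasContractiveInverse_one_sub {w : R} (hw : ∀ t : ℝ, ‖exp ((t : ℂ) • w)‖ ≤ 1) :
    HasContractiveInverse (1 - w) := by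
  set f : ℝ → R := fun s => (Real.exp (-s) : ℂ) • exp ((s : ℂ) • w) with hf
  have hder : ∀ s : ℝ, HasDerivAt f (-((1 - w) * f s)) s := by
    intro s
    have h1 : HasDerivAt (fun s : ℝ => exp ((s : ℂ) • w)) (w * exp ((s : ℂ) • w)) s := by
      have h := (hasDerivAt_exp_smul_const' w (s : ℂ)).scomp s Complex.ofRealCLM.hasDerivAt
      rwa [Complex.ofRealCLM_apply, Complex.ofReal_one, one_smul] at h
    have h2 : HasDerivAt (fun s : ℝ => (Real.exp (-s) : ℂ)) ((-Real.exp (-s) : ℝ) : ℂ) s := by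
      have : HasDerivAt (fun s : ℝ => Real.exp (-s)) (-Real.exp (-s)) s := by
        simpa using (hasDerivAt_neg s).exp
      exact this.ofReal_comp
    refine (h2.smul h1).congr_deriv ?_
    simp only [hf, sub_mul, one_mul, mul_smul_comm, Complex.ofReal_neg, neg_smul,
      smul_sub]
    abel
  have hnorm : ∀ s, ‖f s‖ ≤ Real.exp (-s) := by
    intro s
    rw [hf, norm_smul, Complex.norm_real, Real.norm_eq_abs, abs_of_pos (Real.exp_pos _)]
    exact mul_le_of_le_one_right (Real.exp_pos _).le (hw s)
  have hcont : Continuous f := continuous_iff_continuousAt.2 fun s => (hder s).continuousAt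
  have hint : IntegrableOn f (Set.Ioi 0) :=
    (integrableOn_exp_neg_Ioi 0).mono' hcont.aestronglyMeasurable.restrict
      (Eventually.of_forall hnorm)
  have hlim : Tendsto f atTop (𝓝 0) :=
    squeeze_zero_norm hnorm (Real.tendsto_exp_neg_atTop_nhds_zero)
  have hf0 : f 0 = 1 := by simp [hf]
  have hcomm : ∀ s, (1 - w) * f s = f s * (1 - w) := by
    intro s
    have : Commute w (exp ((s : ℂ) • w)) :=
      ((Commute.refl w).smul_right (s : ℂ)).exp_right
    simp only [hf, sub_mul, mul_sub, one_mul, mul_one, mul_smul_comm, smul_mul_assoc, this.eq,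
      smul_sub]
  have key : ∫ s in Set.Ioi (0 : ℝ), (1 - w) * f s = 1 := by
    have h := integral_Ioi_of_hasDerivAt_of_tendsto' (a := (0 : ℝ)) (f := f)
      (f' := fun s => -((1 - w) * f s)) (fun s _ => hder s) (hint.const_mul (1 - w)).neg hlim
    rw [integral_neg, hf0, zero_sub, neg_inj] at h
    exact h
  refine ⟨∫ s in Set.Ioi (0 : ℝ), f s, ?_, ?_, ?_⟩
  · rw [← integral_const_mul_of_integrable hint, key]
  · rw [← integral_mul_const_of_integrable hint]
    simpa only [← hcomm] using key
  · calc ‖∫ s in Set.Ioi (0 : ℝ), f s‖ ≤ ∫ s in Set.Ioi (0 : ℝ), Real.exp (-s) :=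
        norm_integral_le_of_norm_le (integrableOn_exp_neg_Ioi 0) (Eventually.of_forall hnorm)
      _ = 1 := integral_exp_neg_Ioi_zero

open NormedSpace Polynomial in
/-- A polynomial with constant term one and purely imaginary roots is a product of factors
`1 - X / r` with `r` imaginary. -/
theorem hasContractiveInverse_aeval {d : R} (hd : ∀ t : ℝ, ‖exp ((t * Complex.I : ℂ) • d)‖ ≤ 1)
    (p : ℂ[X]) (hp : p.eval 0 = 1) (hroot : ∀ z, p.IsRoot z → z.re = 0) :
    HasContractiveInverse (aeval d p) := by
  induction hn : p.natDegree generalizing p with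
  | zero =>
    rw [Polynomial.eq_C_of_natDegree_eq_zero hn] at hp ⊢
    have h1 : p.coeff 0 = 1 := by simpa using hp
    refine ⟨1, ?_, ?_, ?_⟩
    · simp [h1]
    · simp [h1]
    · simpa using hd 0
  | succ k ih =>
    have hp0 : p ≠ 0 := by
      rintro rfl
      simp at hp
    obtain ⟨r, hr⟩ := Complex.exists_root (f := p) (by
      rw [Polynomial.degree_eq_natDegree hp0, hn]
      exact_mod_cast Nat.succ_pos k)
    have hr0 : r ≠ 0 := by
      rintro rfl
      simp [Polynomial.IsRoot, hp] at hr
    obtain ⟨q, hq⟩ := Polynomial.dvd_iff_isRoot.2 hr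
    have hpq : p = (1 - C r⁻¹ * X) * (C (-r) * q) := by
      have : (1 - C r⁻¹ * X : ℂ[X]) * C (-r) = X - C r := by
        rw [sub_mul, one_mul, mul_right_comm, ← C_mul, mul_neg, inv_mul_cancel₀ hr0]
        simp only [map_neg, map_one, neg_mul, one_mul]
        ring
      rw [← mul_assoc, this, hq]
    have hq0 : q ≠ 0 := by
      rintro rfl
      simp [hq] at hp0
    have hfac : HasContractiveInverse (1 - r⁻¹ • d) := by
      refine hasContractiveInverse_one_sub fun t => ?_
      have hre := hroot r hr
      have : ((t : ℂ) * r⁻¹) = ((t * (r⁻¹).im : ℝ) : ℂ) * Complex.I := by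
        apply Complex.ext <;> simp [hre]
      rw [smul_smul, this]
      exact hd _
    rw [hpq, map_mul]
    refine HasContractiveInverse.mul ?_ (ih _ ?_ ?_ ?_)
    · simpa [Algebra.smul_def] using hfac
    · rw [hpq] at hp
      simpa using hp
    · intro z hz
      refine hroot z ?_
      rw [hpq]
      exact Polynomial.root_mul_left_of_isRoot _ hz
    · rw [Polynomial.natDegree_C_mul (neg_ne_zero.2 hr0)]
      have := Polynomial.natDegree_mul (Polynomial.X_sub_C_ne_zero r) hq0
      rw [← hq, hn, Polynomial.natDegree_X_sub_C] at this
      omega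

open NormedSpace Filter in
/-- The limit formula `(1 + x / n) ^ n → exp x` in a Banach algebra. It follows from
`n * ‖(1 + x / n) - exp (x / n)‖ → 0`, which is the derivative of the exponential at `0`, and from
the telescoping factorization of a difference of `n`-th powers. -/
theorem tendsto_one_add_smul_pow_exp (h1 : ‖(1 : R)‖ ≤ 1) (x : R) :
    Tendsto (fun n : ℕ => (1 + (n : ℂ)⁻¹ • x) ^ n) atTop (𝓝 (exp x)) := by
  obtain ⟨K, hK⟩ := isCompact_Icc.exists_bound_of_continuousOn (s := Set.Icc (0 : ℝ) 1)
    (f := fun t : ℝ => exp ((t : ℂ) • x)) (by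
      have : Continuous (exp : R → R) := by
        let +nondep : NormedAlgebra ℚ R := .restrictScalars ℚ ℂ R
        exact exp_continuous
      fun_prop)
  have hpow : ∀ n i : ℕ, exp ((n : ℂ)⁻¹ • x) ^ i = exp (((i / n : ℝ) : ℂ) • x) := by
    intro n i
    let +nondep : NormedAlgebra ℚ R := .restrictScalars ℚ ℂ R
    rw [← exp_nsmul, ← Nat.cast_smul_eq_nsmul ℂ, smul_smul]
    push_cast
    rw [div_eq_mul_inv]
  have hpow' : ∀ n i : ℕ, i ≤ n → ‖(1 + (n : ℂ)⁻¹ • x) ^ i‖ ≤ Real.exp ‖x‖ := by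
    intro n i hi
    rcases Nat.eq_zero_or_pos i with rfl | hi0
    · simpa using h1.trans (Real.one_le_exp (norm_nonneg x))
    have hn : (0 : ℝ) < n := by exact_mod_cast hi0.trans_le hi
    calc ‖(1 + (n : ℂ)⁻¹ • x) ^ i‖ ≤ ‖1 + (n : ℂ)⁻¹ • x‖ ^ i := norm_pow_le' _ hi0
      _ ≤ Real.exp (‖x‖ / n) ^ i := by
          gcongr
          calc ‖1 + (n : ℂ)⁻¹ • x‖ ≤ 1 + ‖x‖ / n := by
                refine (norm_add_le _ _).trans (add_le_add h1 ?_)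
                rw [norm_smul, norm_inv, Complex.norm_natCast, div_eq_inv_mul]
            _ ≤ _ := by rw [add_comm]; exact Real.add_one_le_exp _
      _ = Real.exp (i * (‖x‖ / n)) := by rw [← Real.exp_nat_mul]
      _ ≤ Real.exp ‖x‖ := by
          gcongr
          rw [mul_div_assoc', div_le_iff₀ hn, mul_comm]
          gcongr
  have hder : Tendsto (fun n : ℕ => (n : ℂ) • ((1 + (n : ℂ)⁻¹ • x) - exp ((n : ℂ)⁻¹ • x)))
      atTop (𝓝 0) := by
    have h := hasDerivAt_iff_tendsto_slope_zero.1 (hasDerivAt_exp_smul_const' x (0 : ℂ))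
    have hinv : Tendsto (fun n : ℕ => (n : ℂ)⁻¹) atTop (𝓝[≠] 0) := by
      rw [tendsto_nhdsWithin_iff]
      refine ⟨tendsto_inv_atTop_nhds_zero_nat, ?_⟩
      filter_upwards [eventually_gt_atTop 0] with n hn
      simpa using hn.ne'
    have h' := (tendsto_const_nhds (x := x)).sub (h.comp hinv)
    simp only [zero_smul, exp_zero, mul_one, sub_self, zero_add] at h'
    refine h'.congr' ?_
    filter_upwards [eventually_gt_atTop 0] with n hn
    have hn' : (n : ℂ) ≠ 0 := by exact_mod_cast hn.ne'
    simp only [Function.comp, inv_inv, smul_sub, smul_add, smul_smul, mul_inv_cancel₀ hn', one_smul]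
    abel
  have hdiff : Tendsto (fun n : ℕ => (1 + (n : ℂ)⁻¹ • x) ^ n - exp x) atTop (𝓝 0) := by
    have hlim := hder.norm.const_mul (Real.exp ‖x‖ * K)
    rw [norm_zero, mul_zero] at hlim
    refine squeeze_zero_norm' ?_ hlim
    filter_upwards [eventually_gt_atTop 0] with n hn
    have hn' : (n : ℝ) ≠ 0 := by exact_mod_cast hn.ne'
    have hexp : exp x = exp ((n : ℂ)⁻¹ • x) ^ n := by simp [hpow, div_self hn']
    have hcomm : Commute (1 + (n : ℂ)⁻¹ • x) (exp ((n : ℂ)⁻¹ • x)) :=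
      (Commute.one_left _).add_left (Commute.refl _).exp_right
    rw [hexp, ← hcomm.geom_sum₂_mul]
    refine (norm_mul_le _ _).trans ?_
    rw [norm_smul, Complex.norm_natCast, ← mul_assoc]
    gcongr
    calc ‖∑ i ∈ Finset.range n, (1 + (n : ℂ)⁻¹ • x) ^ i * exp ((n : ℂ)⁻¹ • x) ^ (n - 1 - i)‖
        ≤ ∑ i ∈ Finset.range n, Real.exp ‖x‖ * K := by
          refine norm_sum_le_of_le _ fun i hi => (norm_mul_le _ _).trans ?_
          have hi' := Finset.mem_range.1 hi
          refine mul_le_mul (hpow' n i hi'.le) ?_ (norm_nonneg _) (Real.exp_pos _).le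
          rw [hpow]
          refine hK _ ⟨by positivity, div_le_one_of_le₀ ?_ (by positivity)⟩
          exact_mod_cast (by omega : n - 1 - i ≤ n)
      _ = Real.exp ‖x‖ * K * n := by simp [mul_comm]
  simpa using hdiff.add_const (exp x)

open NormedSpace Polynomial in
/-- The roots of the polynomials `((1 + X / n) ^ n + (1 - X / n) ^ n) / 2`, which approximate
the hyperbolic cosine, satisfy `|1 + z / n| = |1 - z / n|` and are therefore imaginary. -/
theorem hasContractiveInverse_cosh {d : R}
    (hd : ∀ t : ℝ, ‖exp ((t * Complex.I : ℂ) • d)‖ ≤ 1) :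
    HasContractiveInverse ((2 : ℂ)⁻¹ • (exp d + exp (-d))) := by
  have h1 : ‖(1 : R)‖ ≤ 1 := by simpa using hd 0
  have hlim := ((tendsto_one_add_smul_pow_exp h1 d).add
    (tendsto_one_add_smul_pow_exp h1 (-d))).const_smul (2 : ℂ)⁻¹
  refine HasContractiveInverse.of_tendsto ?_ hlim
  filter_upwards [Filter.eventually_gt_atTop 0] with n hn
  have hn' : (n : ℝ) ≠ 0 := by exact_mod_cast hn.ne'
  have h := hasContractiveInverse_aeval hd
    (C (2 : ℂ)⁻¹ * ((1 + C (n : ℂ)⁻¹ * X) ^ n + (1 + C (n : ℂ)⁻¹ * -X) ^ n)) (by simp; norm_num) ?_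
  · simpa [Algebra.smul_def] using h
  · intro z hz
    have h2 : (1 + (n : ℂ)⁻¹ * z) ^ n = -(1 + (n : ℂ)⁻¹ * -z) ^ n := by
      simp only [Polynomial.IsRoot, eval_mul, eval_C, eval_add, eval_pow, eval_one, eval_X,
        eval_neg] at hz
      exact eq_neg_of_add_eq_zero_left ((mul_eq_zero.1 hz).resolve_left (by norm_num))
    have h3 : ‖1 + (n : ℂ)⁻¹ * z‖ = ‖1 + (n : ℂ)⁻¹ * -z‖ := by
      refine (pow_left_inj₀ (norm_nonneg _) (norm_nonneg _) hn.ne').1 ?_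
      rw [← norm_pow, ← norm_pow, h2, norm_neg]
    have h4 : Complex.normSq (1 + (n : ℂ)⁻¹ * z) = Complex.normSq (1 + (n : ℂ)⁻¹ * -z) := by
      rw [Complex.normSq_eq_norm_sq, Complex.normSq_eq_norm_sq, h3]
    have h5 : (n : ℂ)⁻¹ = ((n : ℝ)⁻¹ : ℝ) := by push_cast; rfl
    rw [h5, Complex.normSq_apply, Complex.normSq_apply] at h4
    simp only [Complex.add_re, Complex.add_im, Complex.one_re, Complex.one_im,
      Complex.re_ofReal_mul, Complex.im_ofReal_mul, Complex.neg_re, Complex.neg_im] at h4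
    have h6 : (n : ℝ)⁻¹ * z.re = 0 := by linarith
    exact (mul_eq_zero.1 h6).resolve_left (inv_ne_zero hn')

open NormedSpace Filter Asymptotics in
theorem exists_norm_cosh_sub_one_le (d : R) :
    ∃ K : ℝ, ∀ᶠ s : ℝ in 𝓝 0,
      ‖(2 : ℂ)⁻¹ • (exp ((s : ℂ) • d) + exp (-((s : ℂ) • d))) - 1‖ ≤ K * |s| := by
  have h : HasDerivAt (fun z : ℂ => (2 : ℂ)⁻¹ • (exp (z • d) + exp (z • -d))) _ 0 :=
    ((hasDerivAt_exp_smul_const' d (0 : ℂ)).add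
      (hasDerivAt_exp_smul_const' (-d) (0 : ℂ))).const_smul (2 : ℂ)⁻¹
  obtain ⟨K, hK⟩ := h.isBigO_sub.bound
  refine ⟨K, ?_⟩
  have h0 : Tendsto (fun s : ℝ => (s : ℂ)) (𝓝 0) (𝓝 0) := by
    simpa using Complex.continuous_ofReal.tendsto 0
  filter_upwards [h0.eventually hK] with s hs
  have h1 : (2 : ℂ)⁻¹ • ((1 : R) + 1) = 1 := by
    rw [← two_smul ℂ (1 : R), smul_smul, inv_mul_cancel₀ two_ne_zero, one_smul]
  simpa [h1] using hs

end BanachAlgebra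

/-! ### The Banach ideal of a unitarily invariant norm -/

namespace UnitarilyInvariantNorm

variable {H : Type*} [NormedAddCommGroup H] [InnerProductSpace ℂ H] [CompleteSpace H]
  (N : UnitarilyInvariantNorm H)

theorem map_zero : N 0 = 0 := (N.eq_zero_iff 0).2 rfl

theorem map_neg (T : H →L[ℂ] H) : N (-T) = N T := by
  rw [← neg_one_smul ℂ T, N.smul]
  simp

theorem map_sub_comm (S T : H →L[ℂ] H) : N (S - T) = N (T - S) := by
  rw [← N.map_neg, neg_sub]

theorem sum_le {ι : Type*} (s : Finset ι) (f : ι → H →L[ℂ] H) :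
    N (∑ i ∈ s, f i) ≤ ∑ i ∈ s, N (f i) :=
  Finset.le_sum_of_subadditive N.toFun N.map_zero.le N.add_le s f

/-- Left multiplication is bounded on the ideal, because every operator is a combination of four
unitaries. -/
theorem mul_le_left (S T : H →L[ℂ] H) : N (S * T) ≤ ENNReal.ofReal (2 * ‖S‖) * N T := by
  obtain ⟨u, c, hS, hc⟩ := CStarAlgebra.exists_sum_four_unitary S
  have h : S * T = ∑ i, c i • ((u i : H →L[ℂ] H) * T * 1) := by
    conv_lhs => rw [hS]
    simp [Finset.sum_mul]
  calc N (S * T) ≤ ∑ i, N (c i • ((u i : H →L[ℂ] H) * T * 1)) := h ▸ N.sum_le _ _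
    _ ≤ ∑ _i : Fin 4, ENNReal.ofReal (‖S‖ / 2) * N T := by
        refine Finset.sum_le_sum fun i _ => ?_
        rw [N.smul, N.unitary_mul_mul _ (u i).2 _ (one_mem _)]
        gcongr
        exact hc i
    _ = ENNReal.ofReal (2 * ‖S‖) * N T := by
        rw [Finset.sum_const, Finset.card_univ, Fintype.card_fin, ← smul_mul_assoc,
          ← ENNReal.ofReal_nsmul]
        congr 2
        rw [nsmul_eq_mul]
        push_cast
        ring

theorem mul_le_right (T S : H →L[ℂ] H) : N (T * S) ≤ ENNReal.ofReal (2 * ‖S‖) * N T := by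
  obtain ⟨u, c, hS, hc⟩ := CStarAlgebra.exists_sum_four_unitary S
  have h : T * S = ∑ i, c i • (1 * T * (u i : H →L[ℂ] H)) := by
    conv_lhs => rw [hS]
    simp [Finset.mul_sum]
  calc N (T * S) ≤ ∑ i, N (c i • (1 * T * (u i : H →L[ℂ] H))) := h ▸ N.sum_le _ _
    _ ≤ ∑ _i : Fin 4, ENNReal.ofReal (‖S‖ / 2) * N T := by
        refine Finset.sum_le_sum fun i _ => ?_
        rw [N.smul, N.unitary_mul_mul _ (one_mem _) _ (u i).2]
        gcongr
        exact hc i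
    _ = ENNReal.ofReal (2 * ‖S‖) * N T := by
        rw [Finset.sum_const, Finset.card_univ, Fintype.card_fin, ← smul_mul_assoc,
          ← ENNReal.ofReal_nsmul]
        congr 2
        rw [nsmul_eq_mul]
        push_cast
        ring

open Filter InnerProductSpace in
/-- The norm `N` and the operator norm have compatible limits. Compressing by rank one operators,
`⟪y, T x⟫ • rankOne x x = rankOne x y * T * rankOne x x`, reduces this to scalar sequences; the
value `N (rankOne x x)` is nonzero, possibly infinite. -/
theorem eq_of_tendsto {u : ℕ → H →L[ℂ] H} {S T : H →L[ℂ] H} (hu : Tendsto u atTop (𝓝 T))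
    (hN : Tendsto (fun n => N (u n - S)) atTop (𝓝 0)) : T = S := by
  ext x
  refine ext_inner_left ℂ fun y => ?_
  rcases eq_or_ne x 0 with rfl | hx
  · simp
  set q : H →L[ℂ] H := rankOne ℂ x x with hq
  have hq0 : N q ≠ 0 := by
    rw [Ne, N.eq_zero_iff]
    intro h
    have := DFunLike.congr_fun h x
    simp [hq, hx] at this
  obtain ⟨c, hc0, hct, hcq⟩ : ∃ c : ℝ≥0∞, c ≠ 0 ∧ c ≠ ∞ ∧ c ≤ N q :=
    ⟨min 1 (N q), by simp [hq0], by simp, min_le_right _ _⟩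
  have hcomp : ∀ R : H →L[ℂ] H, (inner ℂ y (R x)) • q = rankOne ℂ x y * (R * q) := by
    intro R
    ext z
    change inner ℂ y (R x) • (inner ℂ x z • x) = inner ℂ y (R (inner ℂ x z • x)) • x
    rw [map_smul, inner_smul_right, smul_smul, mul_comm]
  set K := ENNReal.ofReal (2 * ‖(rankOne ℂ x y : H →L[ℂ] H)‖) * ENNReal.ofReal (2 * ‖q‖) with hK
  have hbound : ∀ R : H →L[ℂ] H, ENNReal.ofReal ‖(inner ℂ y (R x) : ℂ)‖ ≤ K * c⁻¹ * N R := by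
    intro R
    have h1 : ENNReal.ofReal ‖(inner ℂ y (R x) : ℂ)‖ * c ≤ K * N R := by
      calc _ ≤ ENNReal.ofReal ‖(inner ℂ y (R x) : ℂ)‖ * N q := by gcongr
        _ = N (rankOne ℂ x y * (R * q)) := by rw [← N.smul, hcomp]
        _ ≤ _ := (N.mul_le_left _ _).trans (by
            rw [hK, mul_assoc]
            gcongr
            exact N.mul_le_right _ _)
    calc _ ≤ K * N R / c := (ENNReal.le_div_iff_mul_le (Or.inl hc0) (Or.inl hct)).2 h1
      _ = _ := by rw [div_eq_mul_inv, mul_right_comm]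
  have hKc : K * c⁻¹ ≠ ∞ := ENNReal.mul_ne_top
    (ENNReal.mul_ne_top ENNReal.ofReal_ne_top ENNReal.ofReal_ne_top) (ENNReal.inv_ne_top.2 hc0)
  have hlim : Tendsto (fun n => ENNReal.ofReal ‖(inner ℂ y ((u n - S) x) : ℂ)‖) atTop (𝓝 0) := by
    have h := ENNReal.Tendsto.const_mul hN (Or.inr hKc)
    rw [mul_zero] at h
    exact tendsto_of_tendsto_of_tendsto_of_le_of_le tendsto_const_nhds h
      (fun _ => zero_le) (fun n => hbound _)
  have hlim' : Tendsto (fun n => ENNReal.ofReal ‖(inner ℂ y ((u n - S) x) : ℂ)‖) atTop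
      (𝓝 (ENNReal.ofReal ‖(inner ℂ y ((T - S) x) : ℂ)‖)) := by
    refine ENNReal.tendsto_ofReal (Tendsto.norm (Tendsto.inner tendsto_const_nhds ?_))
    exact ((ContinuousLinearMap.apply ℂ H x).continuous.tendsto _).comp (hu.sub_const S)
  have h0 := tendsto_nhds_unique hlim' hlim
  rw [ENNReal.ofReal_eq_zero, norm_le_zero_iff] at h0
  simpa [inner_sub_right, sub_eq_zero] using h0

/-- The operator norm, as a unitarily invariant norm. -/
noncomputable def opNorm (H : Type*) [NormedAddCommGroup H] [InnerProductSpace ℂ H]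
    [CompleteSpace H] : UnitarilyInvariantNorm H where
  toFun T := ENNReal.ofReal ‖T‖
  eq_zero_iff T := by simp
  smul c T := by rw [norm_smul, ENNReal.ofReal_mul (norm_nonneg _)]
  add_le S T := by
    rw [← ENNReal.ofReal_add (norm_nonneg _) (norm_nonneg _)]
    exact ENNReal.ofReal_le_ofReal (norm_add_le _ _)
  unitary_mul_mul U hU V hV T := by
    rw [CStarRing.norm_mul_mem_unitary _ hV, CStarRing.norm_mem_unitary_mul _ hU]
  complete u _ hu := by
    have hcau : CauchySeq u := by
      refine Metric.cauchySeq_iff.2 fun ε hε => ?_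
      obtain ⟨n₀, h⟩ := hu (ENNReal.ofReal ε) (by simpa using hε)
      refine ⟨n₀, fun k hk l hl => ?_⟩
      rw [dist_eq_norm]
      exact (ENNReal.ofReal_lt_ofReal_iff hε).1 (h k hk l hl)
    obtain ⟨T, hT⟩ := cauchySeq_tendsto_of_complete hcau
    refine ⟨T, ENNReal.ofReal_lt_top, ?_⟩
    have := ENNReal.tendsto_ofReal (tendsto_iff_norm_sub_tendsto_zero.1 hT)
    simpa using this

/-- The linear subspace of operators of finite norm. -/
def idealSubmodule : Submodule ℂ (H →L[ℂ] H) where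
  carrier := {T | N T < ∞}
  add_mem' {S T} hS hT := (N.add_le S T).trans_lt (ENNReal.add_lt_top.2 ⟨hS, hT⟩)
  zero_mem' := by simp [N.map_zero]
  smul_mem' c T hT := by
    rw [Set.mem_ofPred_eq, N.smul]
    exact ENNReal.mul_lt_top ENNReal.ofReal_lt_top hT

/-- The ideal of operators of finite norm as a Banach space for the norm `N`. It is a type synonym
of the subspace, whose own topology comes from the operator norm. -/
def Ideal : Type _ := N.idealSubmodule

namespace Ideal

noncomputable instance : AddCommGroup N.Ideal := inferInstanceAs (AddCommGroup N.idealSubmodule)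

noncomputable instance : Module ℂ N.Ideal := inferInstanceAs (Module ℂ N.idealSubmodule)

variable {N}

/-- An operator of finite norm, as an element of the ideal. -/
def mk (T : H →L[ℂ] H) (hT : N T < ∞) : N.Ideal := ⟨T, hT⟩

/-- The underlying operator. -/
def toOp (T : N.Ideal) : H →L[ℂ] H := T.1

@[simp] theorem toOp_mk (T : H →L[ℂ] H) (hT : N T < ∞) : (mk T hT).toOp = T := rfl

theorem lt_top (T : N.Ideal) : N T.toOp < ∞ := T.2

theorem toOp_injective : Function.Injective (toOp : N.Ideal → H →L[ℂ] H) := Subtype.val_injective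

@[simp] theorem toOp_add (S T : N.Ideal) : (S + T).toOp = S.toOp + T.toOp := rfl

@[simp] theorem toOp_sub (S T : N.Ideal) : (S - T).toOp = S.toOp - T.toOp := rfl

@[simp] theorem toOp_neg (T : N.Ideal) : (-T).toOp = -T.toOp := rfl

@[simp] theorem toOp_smul (c : ℂ) (T : N.Ideal) : (c • T).toOp = c • T.toOp := rfl

theorem normedSpaceCore :
    letI : Norm N.Ideal := ⟨fun T => (N T.toOp).toReal⟩
    NormedSpace.Core ℂ N.Ideal :=
  letI : Norm N.Ideal := ⟨fun T => (N T.toOp).toReal⟩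
  { norm_nonneg _ := ENNReal.toReal_nonneg
    norm_smul c T := by
      change (N _).toReal = _ * (N _).toReal
      rw [toOp_smul, N.smul, ENNReal.toReal_mul, ENNReal.toReal_ofReal (norm_nonneg _)]
    norm_triangle S T := by
      change (N _).toReal ≤ (N _).toReal + (N _).toReal
      rw [← ENNReal.toReal_add S.lt_top.ne T.lt_top.ne]
      exact ENNReal.toReal_mono (ENNReal.add_lt_top.2 ⟨S.lt_top, T.lt_top⟩).ne (N.add_le _ _)
    norm_eq_zero_iff T := by
      change (N _).toReal = 0 ↔ _
      rw [ENNReal.toReal_eq_zero_iff, or_iff_left T.lt_top.ne, N.eq_zero_iff]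
      exact toOp_injective.eq_iff' rfl }

noncomputable instance : NormedAddCommGroup N.Ideal :=
  letI : Norm N.Ideal := ⟨fun T => (N T.toOp).toReal⟩
  NormedAddCommGroup.ofCore normedSpaceCore

noncomputable instance : NormedSpace ℂ N.Ideal where
  norm_smul_le c T := (normedSpaceCore.norm_smul c T).le

theorem ofReal_norm (T : N.Ideal) : ENNReal.ofReal ‖T‖ = N T.toOp :=
  ENNReal.ofReal_toReal T.lt_top.ne

theorem norm_le_mul_norm_iff {S T : N.Ideal} {c : ℝ} (hc : 0 ≤ c) :
    ‖S‖ ≤ c * ‖T‖ ↔ N S.toOp ≤ ENNReal.ofReal c * N T.toOp := by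
  rw [← ofReal_norm, ← ofReal_norm, ← ENNReal.ofReal_mul hc,
    ENNReal.ofReal_le_ofReal_iff (by positivity)]

instance : CompleteSpace N.Ideal := by
  refine Metric.complete_of_cauchySeq_tendsto fun u hu => ?_
  obtain ⟨T, hT, hlim⟩ := N.complete (fun n => (u n).toOp) (fun n => (u n).lt_top) (by
    intro ε hε
    rcases eq_or_ne ε ∞ with rfl | hε'
    · exact ⟨0, fun k _ l _ => (u k - u l).lt_top⟩
    obtain ⟨n₀, h⟩ := Metric.cauchySeq_iff.1 hu ε.toReal (ENNReal.toReal_pos hε.ne' hε')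
    refine ⟨n₀, fun k hk l hl => ?_⟩
    have := h k hk l hl
    rw [dist_eq_norm] at this
    rw [← toOp_sub, ← ofReal_norm]
    exact (ENNReal.ofReal_lt_iff_lt_toReal (norm_nonneg _) hε').2 this)
  refine ⟨mk T hT, tendsto_iff_norm_sub_tendsto_zero.2 ?_⟩
  exact (ENNReal.tendsto_toReal ENNReal.zero_ne_top).comp hlim

/-- Left multiplication by a bounded operator on the ideal. -/
noncomputable def leftMul (S : H →L[ℂ] H) : N.Ideal →L[ℂ] N.Ideal :=
  LinearMap.mkContinuous
    { toFun := fun T => mk (S * T.toOp) <|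
        (N.mul_le_left _ _).trans_lt (ENNReal.mul_lt_top ENNReal.ofReal_lt_top T.lt_top)
      map_add' := fun _ _ => toOp_injective (mul_add _ _ _)
      map_smul' := fun _ _ => toOp_injective (mul_smul_comm _ _ _) }
    (2 * ‖S‖) fun _ => (norm_le_mul_norm_iff (by positivity)).2 (N.mul_le_left _ _)

theorem norm_leftMul_le (S : H →L[ℂ] H) : ‖(leftMul S : N.Ideal →L[ℂ] N.Ideal)‖ ≤ 2 * ‖S‖ :=
  LinearMap.mkContinuous_norm_le _ (by positivity) _

/-- Right multiplication by a bounded operator on the ideal. -/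
noncomputable def rightMul (S : H →L[ℂ] H) : N.Ideal →L[ℂ] N.Ideal :=
  LinearMap.mkContinuous
    { toFun := fun T => mk (T.toOp * S) <|
        (N.mul_le_right _ _).trans_lt (ENNReal.mul_lt_top ENNReal.ofReal_lt_top T.lt_top)
      map_add' := fun _ _ => toOp_injective (add_mul _ _ _)
      map_smul' := fun _ _ => toOp_injective (smul_mul_assoc _ _ _) }
    (2 * ‖S‖) fun _ => (norm_le_mul_norm_iff (by positivity)).2 (N.mul_le_right _ _)

theorem norm_rightMul_le (S : H →L[ℂ] H) : ‖(rightMul S : N.Ideal →L[ℂ] N.Ideal)‖ ≤ 2 * ‖S‖ :=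
  LinearMap.mkContinuous_norm_le _ (by positivity) _

@[simp] theorem toOp_leftMul (S : H →L[ℂ] H) (T : N.Ideal) :
    (leftMul S T).toOp = S * T.toOp := rfl

@[simp] theorem toOp_rightMul (S : H →L[ℂ] H) (T : N.Ideal) :
    (rightMul S T).toOp = T.toOp * S := rfl

theorem ext_op {P Q : N.Ideal →L[ℂ] N.Ideal} (h : ∀ T, (P T).toOp = (Q T).toOp) : P = Q :=
  ContinuousLinearMap.ext fun T => toOp_injective (h T)

variable (N) in
/-- Left multiplication as a ring homomorphism. -/
noncomputable def leftMulHom : (H →L[ℂ] H) →+* (N.Ideal →L[ℂ] N.Ideal) where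
  toFun := leftMul
  map_one' := ext_op fun _ => one_mul _
  map_mul' _ _ := ext_op fun _ => mul_assoc _ _ _
  map_zero' := ext_op fun _ => zero_mul _
  map_add' _ _ := ext_op fun _ => add_mul _ _ _

variable (N) in
/-- Right multiplication as a ring homomorphism from the opposite ring. -/
noncomputable def rightMulHom : (H →L[ℂ] H)ᵐᵒᵖ →+* (N.Ideal →L[ℂ] N.Ideal) where
  toFun S := rightMul S.unop
  map_one' := ext_op fun _ => mul_one _
  map_mul' _ _ := ext_op fun _ => (mul_assoc _ _ _).symm
  map_zero' := ext_op fun _ => mul_zero _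
  map_add' _ _ := ext_op fun _ => mul_add _ _ _

open NormedSpace in
theorem leftMul_exp (a : H →L[ℂ] H) : (leftMul (exp a) : N.Ideal →L[ℂ] N.Ideal) = exp (leftMul a) := by
  let +nondep : NormedAlgebra ℚ (H →L[ℂ] H) := .restrictScalars ℚ ℂ _
  let +nondep : NormedAlgebra ℚ (N.Ideal →L[ℂ] N.Ideal) := .restrictScalars ℚ ℂ _
  refine map_exp (leftMulHom N) ?_ a
  exact AddMonoidHomClass.continuous_of_bound (leftMulHom N) 2 norm_leftMul_le

open NormedSpace in
theorem rightMul_exp (a : H →L[ℂ] H) :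
    (rightMul (exp a) : N.Ideal →L[ℂ] N.Ideal) = exp (rightMul a) := by
  let +nondep : NormedAlgebra ℚ (H →L[ℂ] H)ᵐᵒᵖ := .restrictScalars ℚ ℂ _
  let +nondep : NormedAlgebra ℚ (N.Ideal →L[ℂ] N.Ideal) := .restrictScalars ℚ ℂ _
  have h := map_exp (rightMulHom N) (AddMonoidHomClass.continuous_of_bound (rightMulHom N) 2 fun S =>
    norm_rightMul_le S.unop) (MulOpposite.op a)
  rwa [exp_op] at h

open NormedSpace in
/-- The group generated by the generalized derivation `T ↦ a T - T b`. -/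
theorem toOp_exp_smul_derivation (a b : H →L[ℂ] H) (z : ℂ) (T : N.Ideal) :
    (exp (z • (leftMul a - rightMul b) : N.Ideal →L[ℂ] N.Ideal) T).toOp = exp (z • a) * T.toOp * exp (-(z • b)) := by
  let +nondep : NormedAlgebra ℚ (N.Ideal →L[ℂ] N.Ideal) := .restrictScalars ℚ ℂ _
  have h : z • (leftMul a - rightMul b : N.Ideal →L[ℂ] N.Ideal)
      = leftMul (z • a) + rightMul (-(z • b)) := by
    refine ext_op fun T => ?_
    simp [sub_eq_add_neg]
  have hcomm : Commute (leftMul (z • a) : N.Ideal →L[ℂ] N.Ideal) (rightMul (-(z • b))) :=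
    ext_op fun T => by simp [mul_assoc]
  rw [h, exp_add_of_commute hcomm, ← leftMul_exp, ← rightMul_exp]
  simp [mul_assoc]

end Ideal

end UnitarilyInvariantNorm

/-! ### The hyperbolic cosine of a derivation -/

section CoshConj

variable {H : Type*} [NormedAddCommGroup H] [InnerProductSpace ℂ H] [CompleteSpace H]

open NormedSpace in
/-- The hyperbolic cosine of `s` times the generalized derivation `T ↦ a T - T b`, that is
`T ↦ (eˢᵃ T e⁻ˢᵇ + e⁻ˢᵃ T eˢᵇ) / 2`. -/
noncomputable def coshConj (a b : H →L[ℂ] H) (s : ℝ) (T : H →L[ℂ] H) : H →L[ℂ] H :=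
  (2 : ℂ)⁻¹ • (exp ((s : ℂ) • a) * T * exp (-((s : ℂ) • b)) +
    exp (-((s : ℂ) • a)) * T * exp ((s : ℂ) • b))

theorem coshConj_add (a b : H →L[ℂ] H) (s : ℝ) (S T : H →L[ℂ] H) :
    coshConj a b s (S + T) = coshConj a b s S + coshConj a b s T := by
  simp only [coshConj, mul_add, add_mul, ← smul_add]
  congr 1
  abel

theorem coshConj_smul (a b : H →L[ℂ] H) (s : ℝ) (c : ℝ) (T : H →L[ℂ] H) :
    coshConj a b s (c • T) = c • coshConj a b s T := by
  simp only [coshConj, mul_smul_comm, smul_mul_assoc, ← smul_add]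
  rw [smul_comm]

theorem coshConj_sub (a b : H →L[ℂ] H) (s : ℝ) (S T : H →L[ℂ] H) :
    coshConj a b s (S - T) = coshConj a b s S - coshConj a b s T := by
  rw [eq_sub_iff_add_eq, ← coshConj_add, sub_add_cancel]

theorem coshConj_sum (a b : H →L[ℂ] H) (s : ℝ) {ι : Type*} (t : Finset ι) (f : ι → H →L[ℂ] H) :
    coshConj a b s (∑ i ∈ t, f i) = ∑ i ∈ t, coshConj a b s (f i) :=
  map_sum (AddMonoidHom.mk' (coshConj a b s) (coshConj_add a b s)) _ _

theorem coshConj_neg (a b : H →L[ℂ] H) (s : ℝ) : coshConj a b (-s) = coshConj a b s := by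
  ext1 T
  simp only [coshConj, Complex.ofReal_neg, neg_smul, neg_neg]
  rw [add_comm]

theorem coshConj_zero (a b T : H →L[ℂ] H) : coshConj a b 0 T = T := by
  simp only [coshConj, Complex.ofReal_zero, zero_smul, neg_zero, NormedSpace.exp_zero, one_mul,
    mul_one]
  rw [← two_smul ℂ T, smul_smul, inv_mul_cancel₀ two_ne_zero, one_smul]

open NormedSpace in
theorem continuous_coshConj (a b T : H →L[ℂ] H) : Continuous fun s => coshConj a b s T := by
  have : Continuous (exp : (H →L[ℂ] H) → (H →L[ℂ] H)) := by
    let +nondep : NormedAlgebra ℚ (H →L[ℂ] H) := .restrictScalars ℚ ℂ _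
    exact exp_continuous
  unfold coshConj
  fun_prop

open NormedSpace in
theorem exp_ofReal_smul_mul_exp_ofReal_smul (a : H →L[ℂ] H) (s t : ℝ) :
    exp ((s : ℂ) • a) * exp ((t : ℂ) • a) = exp (((s + t : ℝ) : ℂ) • a) := by
  let +nondep : NormedAlgebra ℚ (H →L[ℂ] H) := .restrictScalars ℚ ℂ _
  rw [← exp_add_of_commute (((Commute.refl a).smul_left _).smul_right _), ← add_smul]
  push_cast
  rfl

open NormedSpace in
/-- The addition theorem `cosh s cosh t = (cosh (s + t) + cosh (s - t)) / 2`. -/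
theorem coshConj_coshConj (a b : H →L[ℂ] H) (s t : ℝ) (T : H →L[ℂ] H) :
    coshConj a b s (coshConj a b t T) =
      (2 : ℂ)⁻¹ • (coshConj a b (s + t) T + coshConj a b (s - t) T) := by
  have h : ∀ p q r w : ℝ, exp ((p : ℂ) • a) * (exp ((q : ℂ) • a) * T * exp ((r : ℂ) • b)) *
      exp ((w : ℂ) • b) = exp (((p + q : ℝ) : ℂ) • a) * T * exp (((r + w : ℝ) : ℂ) • b) := by
    intro p q r w
    rw [← exp_ofReal_smul_mul_exp_ofReal_smul, ← exp_ofReal_smul_mul_exp_ofReal_smul]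
    simp only [mul_assoc]
  simp only [coshConj, ← neg_smul, ← Complex.ofReal_neg, mul_smul_comm, smul_mul_assoc, mul_add,
    add_mul, h, ← smul_add]
  rw [show -t + -s = -(s + t) by ring, show s + -t = s - t by ring, show t + -s = -(s - t) by ring,
    show -s + t = -(s - t) by ring, show -s + -t = -(s + t) by ring, show -t + s = s - t by ring,
    show t + s = s + t by ring]
  congr 2
  abel

theorem coshConj_comm (a b : H →L[ℂ] H) (s t : ℝ) (T : H →L[ℂ] H) :
    coshConj a b s (coshConj a b t T) = coshConj a b t (coshConj a b s T) := by
  rw [coshConj_coshConj, coshConj_coshConj, add_comm t, ← neg_sub s t, coshConj_neg]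

open NormedSpace in
theorem exp_imaginary_smul_mem_unitary {a : H →L[ℂ] H} (ha : IsSelfAdjoint a) (t : ℝ) :
    exp ((t * Complex.I : ℂ) • a) ∈ unitary (H →L[ℂ] H) := by
  have h := (selfAdjoint.expUnitary (⟨t • a, (IsSelfAdjoint.all t).smul ha⟩ :
    selfAdjoint (H →L[ℂ] H))).2
  rw [selfAdjoint.expUnitary_coe] at h
  have h' : (t * Complex.I : ℂ) • a = Complex.I • (t • a) := by
    rw [← Complex.coe_smul, smul_smul, mul_comm]
  rwa [h']

namespace UnitarilyInvariantNorm

variable (N : UnitarilyInvariantNorm H) {a b : H →L[ℂ] H}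

open NormedSpace in
/-- The restriction of `coshConj a b s` to the ideal of `N`, as an element of the Banach algebra
generated by left and right multiplications. -/
noncomputable def coshDerivation (a b : H →L[ℂ] H) (s : ℝ) : N.Ideal →L[ℂ] N.Ideal :=
  (2 : ℂ)⁻¹ • (exp ((s : ℂ) • (Ideal.leftMul a - Ideal.rightMul b)) +
    exp (-((s : ℂ) • (Ideal.leftMul a - Ideal.rightMul b))))

theorem toOp_coshDerivation (a b : H →L[ℂ] H) (s : ℝ) (T : N.Ideal) :
    (N.coshDerivation a b s T).toOp = coshConj a b s T.toOp := by
  have h := Ideal.toOp_exp_smul_derivation a b (-(s : ℂ)) T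
  rw [neg_smul, neg_smul, neg_smul, neg_neg] at h
  rw [coshConj, ← Ideal.toOp_exp_smul_derivation, ← h]
  rfl

/-- The derivation `T ↦ a T - T b` with `a` and `b` self-adjoint generates a group of isometries of
the ideal at imaginary times, by unitary invariance. -/
theorem hasContractiveInverse_coshDerivation (ha : IsSelfAdjoint a) (hb : IsSelfAdjoint b)
    (s : ℝ) : HasContractiveInverse (N.coshDerivation a b s) := by
  refine hasContractiveInverse_cosh fun t => ?_
  refine ContinuousLinearMap.opNorm_le_bound _ zero_le_one fun T => ?_
  have hz : ((t : ℂ) * Complex.I) * s = ((t * s : ℝ) : ℂ) * Complex.I := by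
    push_cast
    ring
  rw [smul_smul, hz, Ideal.norm_le_mul_norm_iff zero_le_one, Ideal.toOp_exp_smul_derivation,
    ← smul_neg, N.unitary_mul_mul _ (exp_imaginary_smul_mem_unitary ha _) _
      (exp_imaginary_smul_mem_unitary hb.neg _)]
  simp

theorem exists_coshConj_eq_of_lt_top (ha : IsSelfAdjoint a) (hb : IsSelfAdjoint b) (s : ℝ)
    {W : H →L[ℂ] H} (hW : N W < ∞) : ∃ T, coshConj a b s T = W ∧ N T ≤ N W := by
  obtain ⟨v, hv, -, hvn⟩ := N.hasContractiveInverse_coshDerivation ha hb s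
  refine ⟨(v (.mk W hW)).toOp, ?_, ?_⟩
  · have h : N.coshDerivation a b s (v (.mk W hW)) = (N.coshDerivation a b s * v) (.mk W hW) := rfl
    rw [← toOp_coshDerivation, h, hv]
    rfl
  · have := v.le_of_opNorm_le hvn (.mk W hW)
    rwa [Ideal.norm_le_mul_norm_iff zero_le_one, ENNReal.ofReal_one, one_mul] at this

theorem le_coshConj_of_lt_top (ha : IsSelfAdjoint a) (hb : IsSelfAdjoint b) (s : ℝ)
    {T : H →L[ℂ] H} (hT : N T < ∞) : N T ≤ N (coshConj a b s T) := by
  obtain ⟨v, -, hv, hvn⟩ := N.hasContractiveInverse_coshDerivation ha hb s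
  have h := v.le_of_opNorm_le hvn (N.coshDerivation a b s (.mk T hT))
  have h' : v (N.coshDerivation a b s (.mk T hT)) = (v * N.coshDerivation a b s) (.mk T hT) := rfl
  rwa [h', hv, one_apply_eq_self, Ideal.norm_le_mul_norm_iff zero_le_one, ENNReal.ofReal_one, one_mul,
    toOp_coshDerivation] at h

end UnitarilyInvariantNorm

theorem coshConj_injective {a b : H →L[ℂ] H} (ha : IsSelfAdjoint a) (hb : IsSelfAdjoint b)
    (s : ℝ) : Function.Injective (coshConj a b s) := by
  intro S T hST
  have h := (UnitarilyInvariantNorm.opNorm H).le_coshConj_of_lt_top ha hb s (T := S - T)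
    ENNReal.ofReal_lt_top
  rwa [coshConj_sub, hST, sub_self, UnitarilyInvariantNorm.map_zero, nonpos_iff_eq_zero,
    UnitarilyInvariantNorm.eq_zero_iff, sub_eq_zero] at h

namespace UnitarilyInvariantNorm

variable (N : UnitarilyInvariantNorm H) {a b : H →L[ℂ] H}

/-- No finiteness is needed here: when `coshConj a b s T` lies in the ideal, it has a preimage
in the ideal, which is `T` because `coshConj a b s` is injective on all bounded operators. -/
theorem le_coshConj (ha : IsSelfAdjoint a) (hb : IsSelfAdjoint b) (s : ℝ) (T : H →L[ℂ] H) :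
    N T ≤ N (coshConj a b s T) := by
  rcases eq_or_ne (N (coshConj a b s T)) ∞ with h | h
  · rw [h]
    exact le_top
  · obtain ⟨T', hT', hle⟩ := N.exists_coshConj_eq_of_lt_top ha hb s h.lt_top
    rwa [coshConj_injective ha hb s hT'] at hle

theorem exists_coshConj_sub_le (a b : H →L[ℂ] H) : ∃ K : ℝ, ∀ᶠ s in 𝓝 0,
    ∀ T, N T < ∞ → N (coshConj a b s T - T) ≤ ENNReal.ofReal (K * |s|) * N T := by
  obtain ⟨K, hK⟩ := exists_norm_cosh_sub_one_le
    (Ideal.leftMul a - Ideal.rightMul b : N.Ideal →L[ℂ] N.Ideal)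
  refine ⟨K, hK.mono fun s hs T hT => ?_⟩
  have h := ContinuousLinearMap.le_of_opNorm_le _ hs (.mk T hT)
  rw [Ideal.norm_le_mul_norm_iff ((norm_nonneg _).trans hs)] at h
  have h' := toOp_coshDerivation N a b s (.mk T hT)
  rw [Ideal.toOp_mk] at h'
  rw [← h']
  exact h

/-- An operator norm limit of operators of finite norm at most `R` with summable increments in the
norm `N` has norm at most `R`. The norm `N` is not assumed to be lower semicontinuous: completeness
provides a limit in the ideal, which agrees with the operator norm limit. -/
theorem le_of_tendsto_of_summable {u : ℕ → H →L[ℂ] H} {T : H →L[ℂ] H} {R : ℝ≥0∞} {d : ℕ → ℝ}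
    (hu : Filter.Tendsto u Filter.atTop (𝓝 T)) (hR : R ≠ ∞)
    (hle : ∀ᶠ k in Filter.atTop, N (u k) ≤ R)
    (hsub : ∀ᶠ k in Filter.atTop, N (u (k + 1) - u k) ≤ ENNReal.ofReal (d k))
    (hd : ∀ k, 0 ≤ d k) (hs : Summable d) : N T ≤ R := by
  obtain ⟨n₀, hn₀⟩ := Filter.eventually_atTop.1 (hle.and hsub)
  set v : ℕ → N.Ideal := fun k => .mk (u (k + n₀)) ((hn₀ _ (by omega)).1.trans_lt hR.lt_top)
    with hv
  have hcau : CauchySeq v := by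
    refine cauchySeq_of_dist_le_of_summable (fun k => d (k + n₀)) (fun k => ?_)
      ((summable_nat_add_iff n₀).2 hs)
    rw [dist_comm, dist_eq_norm, ← ENNReal.ofReal_le_ofReal_iff (hd _), Ideal.ofReal_norm]
    have := (hn₀ (k + n₀) (by omega)).2
    rwa [add_right_comm] at this
  obtain ⟨S, hS⟩ := cauchySeq_tendsto_of_complete hcau
  have hST : T = S.toOp := by
    refine N.eq_of_tendsto ((Filter.tendsto_add_atTop_iff_nat n₀).2 hu) ?_
    have h := ENNReal.tendsto_ofReal (tendsto_iff_norm_sub_tendsto_zero.1 hS)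
    simpa only [Ideal.ofReal_norm, hv, Ideal.toOp_sub, Ideal.toOp_mk, ENNReal.ofReal_zero] using h
  have h := ENNReal.tendsto_ofReal hS.norm
  simp only [Ideal.ofReal_norm] at h
  rw [hST]
  exact le_of_tendsto' h fun k => (hn₀ _ (by omega)).1

theorem le_of_tendsto_coshConj {s : ℕ → ℝ}
    (hs : Summable fun j => |s j|) {E : ℕ → H →L[ℂ] H}
    (hE : ∀ j, E (j + 1) = coshConj a b (s j) (E j)) {T : H →L[ℂ] H}
    (hT : Filter.Tendsto E Filter.atTop (𝓝 T)) {R : ℝ≥0∞}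
    (hR : ∀ᶠ j in Filter.atTop, N (E j) ≤ R) : N T ≤ R := by
  rcases eq_or_ne R ∞ with rfl | hR'
  · exact le_top
  obtain ⟨K, hK⟩ := N.exists_coshConj_sub_le a b
  have hs0 : Filter.Tendsto s Filter.atTop (𝓝 0) :=
    (tendsto_zero_iff_abs_tendsto_zero s).2 hs.tendsto_atTop_zero
  refine N.le_of_tendsto_of_summable (d := fun j => |K| * R.toReal * |s j|) hT hR' hR ?_
    (fun j => by positivity) (hs.mul_left _)
  filter_upwards [hs0.eventually hK, hR] with j hj hRj
  rw [hE]
  calc _ ≤ ENNReal.ofReal (K * |s j|) * N (E j) := hj _ (hRj.trans_lt hR'.lt_top)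
    _ ≤ ENNReal.ofReal (|K| * |s j|) * ENNReal.ofReal R.toReal := by
        rw [ENNReal.ofReal_toReal hR']
        gcongr
        exact le_abs_self K
    _ = _ := by
        rw [← ENNReal.ofReal_mul (by positivity), mul_right_comm]

/-- The operator `E 0` is recovered from the limit `T` by applying the inverses of the factors
`coshConj a b (s j)` one after another; they do not increase the norm `N`, and the resulting
sequence converges to `E 0` because these inverses are contractive in the operator norm too. -/
theorem le_of_coshConj_tendsto (ha : IsSelfAdjoint a) (hb : IsSelfAdjoint b) {s : ℕ → ℝ}
    (hs : Summable fun j => |s j|) {E : ℕ → H →L[ℂ] H}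
    (hE : ∀ j, E (j + 1) = coshConj a b (s j) (E j)) {T : H →L[ℂ] H}
    (hT : Filter.Tendsto E Filter.atTop (𝓝 T)) : N (E 0) ≤ N T := by
  rcases eq_or_ne (N T) ∞ with hR | hR
  · rw [hR]
    exact le_top
  have hstep : ∀ (j : ℕ) (W : {W : H →L[ℂ] H // N W ≤ N T}),
      ∃ V : {V : H →L[ℂ] H // N V ≤ N T}, coshConj a b (s j) V = W := by
    intro j W
    obtain ⟨V, hV, hle⟩ := N.exists_coshConj_eq_of_lt_top ha hb (s j) (W.2.trans_lt hR.lt_top)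
    exact ⟨⟨V, hle.trans W.2⟩, hV⟩
  choose inv hinv using hstep
  set V : ℕ → {V : H →L[ℂ] H // N V ≤ N T} := fun j => Nat.rec ⟨T, le_rfl⟩ inv j with hVdef
  have hV : ∀ j, coshConj a b (s j) (V (j + 1)) = V j := fun j => hinv j (V j)
  -- `G j W` is the product of the first `j` factors, applied to `W`.
  set G : ℕ → (H →L[ℂ] H) → (H →L[ℂ] H) :=
    fun j W => Nat.rec W (fun i S => coshConj a b (s i) S) j with hG
  have hGs : ∀ j W, G (j + 1) W = coshConj a b (s j) (G j W) := fun _ _ => rfl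
  have hGcomm : ∀ j t W, G j (coshConj a b t W) = coshConj a b t (G j W) := by
    intro j t W
    induction j with
    | zero => rfl
    | succ j ih => rw [hGs, hGs, ih, coshConj_comm]
  have hGE : ∀ j, G j (E 0) = E j := by
    intro j
    induction j with
    | zero => rfl
    | succ j ih => rw [hGs, ih, hE]
  have hop : ∀ t (W : H →L[ℂ] H), ‖W‖ ≤ ‖coshConj a b t W‖ := fun t W =>
    (ENNReal.ofReal_le_ofReal_iff (norm_nonneg _)).1 ((opNorm H).le_coshConj ha hb t W)
  have hdist : ∀ j W, ‖(V j : H →L[ℂ] H) - W‖ ≤ ‖T - G j W‖ := by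
    intro j
    induction j with
    | zero => exact fun W => le_rfl
    | succ j ih =>
      intro W
      refine (hop (s j) _).trans ?_
      rw [coshConj_sub, hV, hGs, ← hGcomm]
      exact ih _
  have hVlim : Filter.Tendsto (fun j => (V j : H →L[ℂ] H)) Filter.atTop (𝓝 (E 0)) := by
    rw [tendsto_iff_norm_sub_tendsto_zero]
    refine squeeze_zero (fun _ => norm_nonneg _) (fun j => hdist j (E 0)) ?_
    simp only [hGE]
    simpa using (tendsto_const_nhds (x := T)).sub hT |>.norm
  obtain ⟨K, hK⟩ := N.exists_coshConj_sub_le a b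
  have hs0 : Filter.Tendsto s Filter.atTop (𝓝 0) :=
    (tendsto_zero_iff_abs_tendsto_zero s).2 hs.tendsto_atTop_zero
  refine N.le_of_tendsto_of_summable (d := fun j => |K| * (N T).toReal * |s j|) hVlim hR
    (Filter.Eventually.of_forall fun j => (V j).2) ?_ (fun j => by positivity) (hs.mul_left _)
  filter_upwards [hs0.eventually hK] with j hj
  rw [N.map_sub_comm, ← hV j]
  calc _ ≤ ENNReal.ofReal (K * |s j|) * N (V (j + 1)) := hj _ ((V (j + 1)).2.trans_lt hR.lt_top)
    _ ≤ ENNReal.ofReal (|K| * |s j|) * ENNReal.ofReal (N T).toReal := by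
        rw [ENNReal.ofReal_toReal hR]
        gcongr
        · exact le_abs_self K
        · exact (V (j + 1)).2
    _ = _ := by
        rw [← ENNReal.ofReal_mul (by positivity), mul_right_comm]

end UnitarilyInvariantNorm

end CoshConj

/-! ### Convergence of midpoint sums -/

section RiemannSums

variable {E : Type*} [NormedAddCommGroup E] [NormedSpace ℝ E]

/-- The midpoint Riemann sums over the uniform partitions of the unit interval converge. -/
theorem tendsto_midpoint_sum_integral [CompleteSpace E] {f : ℝ → E} (hf : Continuous f) :
    Filter.Tendsto (fun M : ℕ => (1 / (M : ℝ)) • ∑ i ∈ Finset.range M, f ((2 * i + 1) / (2 * M)))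
      Filter.atTop (𝓝 (∫ t in (0 : ℝ)..1, f t)) := by
  rw [Metric.tendsto_atTop]
  intro ε hε
  obtain ⟨δ, hδ, h⟩ := Metric.uniformContinuousOn_iff.1
    (isCompact_Icc.uniformContinuousOn_of_continuous (s := Set.Icc (0 : ℝ) 1) hf.continuousOn)
    (ε / 2) (by positivity)
  obtain ⟨M₀, hM₀⟩ := exists_nat_gt (1 / δ)
  refine ⟨M₀, fun M hM => ?_⟩
  have hMδ : 1 / δ < M := hM₀.trans_le (by exact_mod_cast hM)
  have hM0 : (0 : ℝ) < M := (by positivity : 0 < 1 / δ).trans hMδ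
  have hM1 : 1 / (M : ℝ) < δ := by rwa [one_div_lt hM0 hδ]
  have hint : ∫ t in (0 : ℝ)..1, f t =
      ∑ i ∈ Finset.range M, ∫ t in ((i : ℕ) / M : ℝ)..((i + 1 : ℕ) / M : ℝ), f t := by
    rw [intervalIntegral.sum_integral_adjacent_intervals (a := fun i : ℕ => (i / M : ℝ))
      fun _ _ => hf.intervalIntegrable _ _]
    simp [hM0.ne']
  have hterm : ∀ i ∈ Finset.range M, ‖(1 / (M : ℝ)) • f ((2 * i + 1) / (2 * M)) -
      ∫ t in ((i : ℕ) / M : ℝ)..((i + 1 : ℕ) / M : ℝ), f t‖ ≤ ε / 2 * (1 / M) := by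
    intro i hi
    have hiM : (i : ℝ) + 1 ≤ M := by exact_mod_cast Finset.mem_range.1 hi
    have hi0 : (0 : ℝ) ≤ i := by positivity
    have hlen : (((i + 1 : ℕ) : ℝ) / M - (i : ℕ) / M : ℝ) = 1 / M := by
      push_cast
      ring
    have hle : ((i : ℕ) / M : ℝ) ≤ ((i + 1 : ℕ) / M : ℝ) := by
      have : (0 : ℝ) < 1 / M := by positivity
      linarith
    have hc : (1 / (M : ℝ)) • f ((2 * i + 1) / (2 * M)) =
        ∫ _t in ((i : ℕ) / M : ℝ)..((i + 1 : ℕ) / M : ℝ), f ((2 * i + 1) / (2 * M)) := by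
      rw [intervalIntegral.integral_const, hlen]
    rw [hc, ← intervalIntegral.integral_sub intervalIntegrable_const (hf.intervalIntegrable _ _)]
    have hb := intervalIntegral.norm_integral_le_of_norm_le_const (C := ε / 2)
      (a := ((i : ℕ) / M : ℝ)) (b := ((i + 1 : ℕ) / M : ℝ))
      (f := fun t => f ((2 * i + 1) / (2 * M)) - f t) (by
        intro t ht
        rw [Set.uIoc_of_le hle] at ht
        have ht2 : t ≤ (i + 1) / M := by simpa using ht.2
        have hmid : ((2 * i + 1) / (2 * M) : ℝ) = i / M + 1 / M / 2 := by
          field_simp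
        have hsum : ((i : ℝ) + 1) / M = i / M + 1 / M := add_div _ _ _
        have hi0' : 0 ≤ (i : ℝ) / M := by positivity
        have hi1' : (i + 1 : ℝ) / M ≤ 1 := (div_le_one hM0).2 hiM
        have hMp : 0 < 1 / (M : ℝ) := by positivity
        rw [← dist_eq_norm]
        refine (h _ ⟨?_, ?_⟩ _ ⟨?_, ?_⟩ ?_).le
        · positivity
        · linarith
        · linarith [ht.1]
        · linarith
        · rw [Real.dist_eq, abs_lt]
          constructor <;> linarith [ht.1])
    rwa [hlen, abs_of_pos (by positivity)] at hb
  rw [dist_eq_norm, hint, Finset.smul_sum, ← Finset.sum_sub_distrib]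
  calc _ ≤ ∑ i ∈ Finset.range M, ε / 2 * (1 / M) := norm_sum_le_of_le _ hterm
    _ = ε / 2 := by
        rw [Finset.sum_const, Finset.card_range, nsmul_eq_mul]
        field_simp
    _ < ε := by linarith

theorem sum_Icc_two_mul {M : Type*} [AddCommMonoid M] (f : ℕ → M) (n : ℕ) :
    ∑ i ∈ Finset.Icc 1 (2 * n), f i = ∑ i ∈ Finset.Icc 1 n, (f (2 * i) + f (2 * i - 1)) := by
  induction n with
  | zero => simp
  | succ n ih =>
    rw [Finset.sum_Icc_succ_top (by omega), ← ih, show 2 * (n + 1) = 2 * n + 1 + 1 by ring,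
      Finset.sum_Icc_succ_top (by omega), Finset.sum_Icc_succ_top (by omega), add_assoc,
      add_comm (f (2 * n + 1))]
    rfl

theorem sum_Icc_one_eq_sum_range {M : Type*} [AddCommMonoid M] (f : ℕ → M) (n : ℕ) :
    ∑ i ∈ Finset.Icc 1 n, f i = ∑ i ∈ Finset.range n, f (i + 1) := by
  induction n with
  | zero => simp
  | succ n ih => rw [Finset.sum_Icc_succ_top (by omega), ih, Finset.sum_range_succ]

end RiemannSums

/-! ### Heinz terms -/

section Heinz

variable {H : Type*} [NormedAddCommGroup H] [InnerProductSpace ℂ H] [CompleteSpace H]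
  {A B : H →L[ℂ] H}

theorem rpow_eq_exp_smul_log (hA : A.IsPositive) (hA' : IsUnit A) (s : ℝ) :
    A ^ s = NormedSpace.exp ((s : ℂ) • CFC.log A) := by
  have hA0 : 0 ≤ A := (ContinuousLinearMap.nonneg_iff_isPositive A).2 hA
  have hpos : ∀ x ∈ spectrum ℝ A, 0 < x := fun x hx =>
    (spectrum_nonneg_of_nonneg hA0 hx).lt_of_ne' fun h => spectrum.zero_notMem ℝ hA' (h ▸ hx)
  have hlog : ContinuousOn Real.log (spectrum ℝ A) :=
    Real.continuousOn_log.mono fun x hx => (hpos x hx).ne'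
  rw [Complex.coe_smul, ← CFC.real_exp_eq_normedSpace_exp ((IsSelfAdjoint.all s).smul .log),
    CFC.rpow_eq_cfc_real hA0, CFC.log, ← cfc_smul s Real.log A hlog,
    ← cfc_comp' Real.exp (fun x => s • Real.log x) A (by fun_prop) (by fun_prop)]
  refine cfc_congr fun x hx => ?_
  rw [Real.rpow_def_of_pos (hpos x hx), smul_eq_mul, mul_comm]

/-- The Heinz term is a hyperbolic cosine of the derivation `T ↦ log A T - T log B`, centred
at the exponent `1 / 2`. -/
theorem heinzTerm_eq_coshConj (hA : A.IsPositive) (hA' : IsUnit A) (hB : B.IsPositive)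
    (hB' : IsUnit B) (X : H →L[ℂ] H) (ν : ℝ) :
    heinzTerm A B X ν = (2 : ℂ) • coshConj (CFC.log A) (CFC.log B) (ν - 1 / 2)
      (A ^ (1 / 2 : ℝ) * X * B ^ (1 / 2 : ℝ)) := by
  have h : ∀ p q r w : ℝ, A ^ p * (A ^ q * X * B ^ r) * B ^ w = A ^ (p + q) * X * B ^ (r + w) := by
    intro p q r w
    rw [CFC.rpow_add hA', CFC.rpow_add hB']
    simp only [mul_assoc]
  simp only [coshConj, ← neg_smul, ← Complex.ofReal_neg]
  simp only [← rpow_eq_exp_smul_log hA hA', ← rpow_eq_exp_smul_log hB hB', h, smul_smul]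
  rw [mul_inv_cancel₀ two_ne_zero, one_smul, heinzTerm]
  ring_nf

theorem continuous_heinzTerm (hA : A.IsPositive) (hA' : IsUnit A) (hB : B.IsPositive)
    (hB' : IsUnit B) (X : H →L[ℂ] H) : Continuous (heinzTerm A B X) := by
  simp only [funext (heinzTerm_eq_coshConj hA hA' hB hB' X)]
  exact ((continuous_coshConj (CFC.log A) (CFC.log B) _).comp
    (continuous_sub_right (1 / 2 : ℝ))).const_smul (2 : ℂ)

theorem coshConj_heinzTerm (hA : A.IsPositive) (hA' : IsUnit A) (hB : B.IsPositive)
    (hB' : IsUnit B) (X : H →L[ℂ] H) (s ν : ℝ) :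
    coshConj (CFC.log A) (CFC.log B) s (heinzTerm A B X ν) =
      (1 / 2 : ℝ) • (heinzTerm A B X (ν + s) + heinzTerm A B X (ν - s)) := by
  have h2 : ∀ T : H →L[ℂ] H, (2 : ℂ) • T = (2 : ℝ) • T := fun T => by
    rw [← Complex.coe_smul, Complex.ofReal_ofNat]
  simp only [heinzTerm_eq_coshConj hA hA' hB hB']
  rw [h2, coshConj_smul, coshConj_coshConj, ← h2, smul_smul, mul_inv_cancel₀ two_ne_zero, one_smul,
    ← smul_add, h2, smul_smul, show (1 / 2 : ℝ) * 2 = 1 by norm_num, one_smul]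
  rw [show s - (ν - 1 / 2) = -(ν - s - 1 / 2) by ring, coshConj_neg,
    show s + (ν - 1 / 2) = ν + s - 1 / 2 by ring]

/-- Halving the mesh of the midpoint sum splits each node symmetrically. -/
theorem midpointSum_succ (hA : A.IsPositive) (hA' : IsUnit A) (hB : B.IsPositive)
    (hB' : IsUnit B) (X : H →L[ℂ] H) (α β : ℝ) (k : ℕ) :
    midpointSum A B X α β (k + 2) = coshConj (CFC.log A) (CFC.log B) ((β - α) / 2 ^ (k + 2))
      (midpointSum A B X α β (k + 1)) := by
  rw [midpointSum, midpointSum, coshConj_smul, coshConj_sum]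
  simp only [coshConj_heinzTerm hA hA' hB hB', ← Finset.smul_sum, smul_smul]
  rw [show k + 2 - 1 = k + 1 by omega, show k + 1 - 1 = k by omega, pow_succ (2 : ℕ) k, mul_comm (2 ^ k) 2,
    sum_Icc_two_mul]
  congr 1
  · rw [pow_succ]
    field_simp
  · refine Finset.sum_congr rfl fun i hi => ?_
    have hi1 : 1 ≤ 2 * i := by
      have := (Finset.mem_Icc.1 hi).1
      omega
    push_cast [Nat.cast_sub hi1]
    congr 2
    · rw [segmentPath, segmentPath]
      field_simp
      ring
    · rw [segmentPath, segmentPath]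
      field_simp
      ring

theorem trapezoidSum_eq_coshConj (hA : A.IsPositive) (hA' : IsUnit A) (hB : B.IsPositive)
    (hB' : IsUnit B) (X : H →L[ℂ] H) (α β : ℝ) (k : ℕ) :
    trapezoidSum A B X α β (k + 1) = coshConj (CFC.log A) (CFC.log B) ((β - α) / 2 ^ (k + 1))
      (midpointSum A B X α β (k + 1)) := by
  rw [midpointSum, trapezoidSum, coshConj_smul, coshConj_sum]
  simp only [coshConj_heinzTerm hA hA' hB hB', ← Finset.smul_sum, smul_smul]
  rw [show k + 1 - 1 = k by omega]
  congr 1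
  · rw [pow_succ]
    field_simp
  · refine Finset.sum_congr rfl fun i hi => ?_
    rw [add_comm]
    congr 2
    · rw [segmentPath, segmentPath]
      field_simp
      ring
    · rw [segmentPath, segmentPath]
      field_simp
      ring

/-- The half-angle formula `cosh (2 u) + 1 = 2 cosh u ^ 2`. -/
theorem trapezoidSum_succ (hA : A.IsPositive) (hA' : IsUnit A) (hB : B.IsPositive)
    (hB' : IsUnit B) (X : H →L[ℂ] H) (α β : ℝ) (k : ℕ) :
    trapezoidSum A B X α β (k + 2) =
      (2 : ℂ)⁻¹ • (trapezoidSum A B X α β (k + 1) + midpointSum A B X α β (k + 1)) := by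
  rw [trapezoidSum_eq_coshConj hA hA' hB hB', trapezoidSum_eq_coshConj hA hA' hB hB',
    midpointSum_succ hA hA' hB hB', coshConj_coshConj, sub_self, coshConj_zero]
  congr 4
  rw [pow_succ]
  field_simp
  ring

/-- The midpoint sums converge to the mean value of the Heinz terms in the operator norm. -/
theorem tendsto_midpointSum (hA : A.IsPositive) (hA' : IsUnit A) (hB : B.IsPositive)
    (hB' : IsUnit B) (X : H →L[ℂ] H) {α β : ℝ} (hαβ : α ≠ β) :
    Filter.Tendsto (fun k => midpointSum A B X α β (k + 1)) Filter.atTop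
      (𝓝 ((β - α)⁻¹ • ∫ ν in α..β, heinzTerm A B X ν)) := by
  have hc : Continuous fun t => heinzTerm A B X (segmentPath α β t) :=
    (continuous_heinzTerm hA hA' hB hB' X).comp (by unfold segmentPath; fun_prop)
  have h := (tendsto_midpoint_sum_integral hc).comp
    (tendsto_pow_atTop_atTop_of_one_lt (one_lt_two (α := ℕ)))
  have hI : ∫ t in (0 : ℝ)..1, heinzTerm A B X (segmentPath α β t) =
      (β - α)⁻¹ • ∫ ν in α..β, heinzTerm A B X ν := by
    have h1 : ∀ t, segmentPath α β t = (β - α) * t + α := fun t => by rw [segmentPath]; ring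
    simp only [h1]
    rw [intervalIntegral.integral_comp_mul_add _ (sub_ne_zero.2 hαβ.symm)]
    simp
  rw [hI] at h
  refine h.congr fun k => ?_
  simp only [Function.comp_apply, midpointSum]
  rw [show k + 1 - 1 = k by omega, sum_Icc_one_eq_sum_range]
  push_cast
  congr 1
  refine Finset.sum_congr rfl fun i _ => ?_
  congr 2
  rw [pow_succ]
  ring

end Heinz

theorem theoremt2 {H : Type*} [NormedAddCommGroup H] [InnerProductSpace ℂ H] [CompleteSpace H]
    (N : UnitarilyInvariantNorm H) (A B X : H →L[ℂ] H)
    (hA : A.IsPositive) (hA' : IsUnit A) (hB : B.IsPositive) (hB' : IsUnit B) (α β : ℝ) :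
    N (heinzTerm A B X ((α + β) / 2)) = N (midpointSum A B X α β 1) ∧
    (∀ k n : ℕ, 1 ≤ k → k ≤ n → N (midpointSum A B X α β k) ≤ N (midpointSum A B X α β n)) ∧
    IntervalIntegrable (heinzTerm A B X) MeasureTheory.volume α β ∧
    (α ≠ β → ∀ n : ℕ, 1 ≤ n →
      N (midpointSum A B X α β n) ≤
        ENNReal.ofReal (1 / |β - α|) * N (∫ ν in α..β, heinzTerm A B X ν)) ∧
    (α ≠ β → ∀ m : ℕ, 1 ≤ m →
      ENNReal.ofReal (1 / |β - α|) * N (∫ ν in α..β, heinzTerm A B X ν) ≤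
        N (trapezoidSum A B X α β m)) ∧
    (∀ k m : ℕ, 1 ≤ k → k ≤ m →
      N (trapezoidSum A B X α β m) ≤ N (trapezoidSum A B X α β k)) ∧
    N (trapezoidSum A B X α β 1) =
      (1 / 2) * N (heinzTerm A B X α + heinzTerm A B X β) := by
  have ha : IsSelfAdjoint (CFC.log A) := .log
  have hb : IsSelfAdjoint (CFC.log B) := .log
  have hE_mono : Monotone fun k => N (midpointSum A B X α β (k + 1)) :=
    monotone_nat_of_le_succ fun k => by
      rw [midpointSum_succ hA hA' hB hB']
      exact N.le_coshConj ha hb _ _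
  have hEF : ∀ k, N (midpointSum A B X α β (k + 1)) ≤ N (trapezoidSum A B X α β (k + 1)) :=
    fun k => by
      rw [trapezoidSum_eq_coshConj hA hA' hB hB']
      exact N.le_coshConj ha hb _ _
  have hF_anti : Antitone fun k => N (trapezoidSum A B X α β (k + 1)) :=
    antitone_nat_of_succ_le fun k => by
      rw [trapezoidSum_succ hA hA' hB hB', N.smul]
      calc _ ≤ ENNReal.ofReal ‖(2 : ℂ)⁻¹‖ *
            (N (trapezoidSum A B X α β (k + 1)) + N (trapezoidSum A B X α β (k + 1))) := by
            gcongr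
            exact (N.add_le _ _).trans (add_le_add le_rfl (hEF k))
        _ = _ := by
            rw [← two_mul, ← mul_assoc, norm_inv, RCLike.norm_ofNat,
              ENNReal.ofReal_inv_of_pos two_pos, ENNReal.ofReal_ofNat,
              ENNReal.inv_mul_cancel two_ne_zero ENNReal.ofNat_ne_top, one_mul]
  have hmean : N ((β - α)⁻¹ • ∫ ν in α..β, heinzTerm A B X ν) =
      ENNReal.ofReal (1 / |β - α|) * N (∫ ν in α..β, heinzTerm A B X ν) := by
    rw [← Complex.coe_smul, N.smul, Complex.norm_real, norm_inv, Real.norm_eq_abs, one_div]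
  have hsum : Summable fun j => |(β - α) / 2 ^ (j + 2)| := by
    have : ∀ j : ℕ, |(β - α) / 2 ^ (j + 2)| = |β - α| / 4 * (1 / 2) ^ j := by
      intro j
      rw [abs_div, abs_of_pos (by positivity : (0 : ℝ) < 2 ^ (j + 2)), pow_add, one_div, inv_pow]
      field_simp
      norm_num
    simp only [this]
    exact summable_geometric_two.mul_left _
  refine ⟨?_, ?_, (continuous_heinzTerm hA hA' hB hB' X).intervalIntegrable _ _, ?_, ?_, ?_, ?_⟩
  · congr 1
    simp only [midpointSum, segmentPath]
    norm_num
    congr 1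
    ring
  · intro k n hk hkn
    obtain ⟨k, rfl⟩ := Nat.exists_eq_add_of_le' hk
    obtain ⟨n, rfl⟩ := Nat.exists_eq_add_of_le' (hk.trans hkn)
    exact hE_mono (by omega)
  · intro hαβ n hn
    obtain ⟨n, rfl⟩ := Nat.exists_eq_add_of_le' hn
    rw [← hmean]
    have hlim := (tendsto_midpointSum hA hA' hB hB' X hαβ).comp (Filter.tendsto_add_atTop_nat n)
    have hrec : ∀ j, midpointSum A B X α β (j + 1 + n + 1) =
        coshConj (CFC.log A) (CFC.log B) ((β - α) / 2 ^ (j + n + 2))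
          (midpointSum A B X α β (j + n + 1)) := fun j => by
      rw [add_right_comm j 1 n]
      exact midpointSum_succ hA hA' hB hB' X α β (j + n)
    have hsum' : Summable fun j => |(β - α) / 2 ^ (j + n + 2)| := (summable_nat_add_iff n).2 hsum
    have h := N.le_of_coshConj_tendsto ha hb hsum' hrec hlim
    rwa [Function.comp_apply, zero_add] at h
  · intro hαβ m hm
    obtain ⟨m, rfl⟩ := Nat.exists_eq_add_of_le' hm
    rw [← hmean]
    refine N.le_of_tendsto_coshConj hsum (fun j => midpointSum_succ hA hA' hB hB' X α β j)
      (tendsto_midpointSum hA hA' hB hB' X hαβ) ?_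
    filter_upwards [Filter.eventually_ge_atTop m] with j hj
    exact (hEF j).trans (hF_anti hj)
  · intro k m hk hkm
    obtain ⟨k, rfl⟩ := Nat.exists_eq_add_of_le' hk
    obtain ⟨m, rfl⟩ := Nat.exists_eq_add_of_le' (hk.trans hkm)
    exact hF_anti (by omega)
  · have h : trapezoidSum A B X α β 1 =
        (2 : ℂ)⁻¹ • (heinzTerm A B X α + heinzTerm A B X β) := by
      simp [trapezoidSum, segmentPath, ← Complex.coe_smul]
    rw [h, N.smul, norm_inv, RCLike.norm_ofNat, ENNReal.ofReal_inv_of_pos two_pos,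
      ENNReal.ofReal_ofNat, one_div]
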